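/- Let $\mathbb D=\{z\in\mathbb C:|z|<1\}$ and $0\le\alpha<1$. Let $\mathcal H$ be the class of complex-valued harmonic functions $f$ on $\mathbb D$ with $f(0)=0$ and $f_z(0)=1$, and let $\mathcal S_H^*$ be the class of those $f\in\mathcal H$ that are univalent and sense-preserving (that is, $|f_{\bar z}|<|f_z|$ on $\mathbb D$) and map $\mathbb D$ onto a domain starlike with respect to the origin. A harmonic map $f$ of $\mathbb D$ with $f(0)=0$ is fully starlike of order $\alpha$ if, for every $0<r<1$, it maps the circle $|z|=r$ in a one-to-one manner onto a curve that bounds a domain starlike with respect to the origin and $$\frac{\partial}{\partial\theta}\arg f(re^{i\theta})>\alpha\qquad\text{for all }\theta,$$ where $f\ne0$ on $|z|=r$ and $\arg f(re^{i\theta})$ is a differentiable branch of the argument along the curve. Let $\mathcal{FS}_H^*(\alpha)$ be the class of functions in $\mathcal S_H^*$ that are fully starlike of order $\alpha$. **Theorem.** Let $f=h+\overline g\in\mathcal H$ be sense-preserving, where $h$ and $g$ are analytic in $\mathbb D$ with $h(0)=g(0)=0$ and $h'(0)=1$. Then $f\in\mathcal{FS}_H^*(\alpha)$ if and only if $f(z)\ne0$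 for $0<|z|<1$ and $$|h(z)|^2\left(\operatorname{Re}\frac{zh'(z)}{h(z)}-\alpha\right)>|g(z)|^2\left(\operatorname{Re}\frac{zg'(z)}{g(z)}+\alpha\right)+\operatorname{Re}\bigl(zh(z)g'(z)+2\alpha h(z)g(z)-zh'(z)g(z)\bigr)$$ for all $z$ with $0<|z|<1$. Here $|h|^2\operatorname{Re}(zh'/h)$ and $|g|^2\operatorname{Re}(zg'/g)$ stand for $\operatorname{Re}(zh'\overline h)$ and $\operatorname{Re}(zg'\overline g)$; in particular they are $0$ where $h$, respectively $g$, vanishes. -/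

import Mathlib

open Complex Metric ComplexConjugate

noncomputable section

namespace HarmonicMaps

/-- The open unit disk `𝔻 = {z : |z| < 1}`. -/
def disk : Set ℂ := ball 0 1

/-- The Wirtinger derivative `f_z = (f_x - i f_y) / 2`, from the real derivative of `f`. -/
def dz (f : ℂ → ℂ) (z : ℂ) : ℂ := (fderiv ℝ f z 1 - I * fderiv ℝ f z I) / 2

/-- The Wirtinger derivative `f_{\bar z} = (f_x + i f_y) / 2`. -/
def dzbar (f : ℂ → ℂ) (z : ℂ) : ℂ := (fderiv ℝ f z 1 + I * fderiv ℝ f z I) / 2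

/-- `f` is sense-preserving in the disk: its Jacobian `|f_z|² - |f_{\bar z}|²` is positive there.
For `f = h + conj g` with `h`, `g` analytic this reads `|g'| < |h'|`. -/
def SensePreserving (f : ℂ → ℂ) : Prop :=
  ∀ z ∈ disk, ‖dzbar f z‖ < ‖dz f z‖

/-- The class `𝓗`: complex-valued harmonic functions in the disk, `f(0) = 0 = f_z(0) - 1`.
(Functions are total on `ℂ`; only their values in the disk matter.) -/
def ClassH : Set (ℂ → ℂ) :=
  {f | InnerProductSpace.HarmonicOnNhd f disk ∧ f 0 = 0 ∧ dz f 0 = 1}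

/-- The class `𝓢_H`: univalent sense-preserving functions in `𝓗`. -/
def ClassSH : Set (ℂ → ℂ) :=
  {f | f ∈ ClassH ∧ Set.InjOn f disk ∧ SensePreserving f}

/-- The class `𝓢*_H`: functions in `𝓢_H` that map the disk onto a domain starlike with respect to
the origin. -/
def ClassSHStar : Set (ℂ → ℂ) :=
  {f | f ∈ ClassSH ∧ IsOpen (f '' disk) ∧ IsConnected (f '' disk) ∧ StarConvex ℝ 0 (f '' disk)}

/-- The set `C` is the boundary of a bounded domain that is starlike with respect to the origin. -/
def BoundsStarlikeDomain (C : Set ℂ) : Prop :=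
  ∃ Ω : Set ℂ, IsOpen Ω ∧ IsConnected Ω ∧ Bornology.IsBounded Ω ∧ StarConvex ℝ 0 Ω ∧
    frontier Ω = C

/-- The closed curve `θ ↦ γ θ` avoids the origin and `(d/dθ) arg γ(θ) > α` for all `θ`, where
`arg γ` is a branch `φ` of the argument along the curve. -/
def ArgDerivGT (γ : ℝ → ℂ) (α : ℝ) : Prop :=
  (∀ θ : ℝ, γ θ ≠ 0) ∧
  ∃ φ : ℝ → ℝ, Differentiable ℝ φ ∧
    (∀ θ : ℝ, γ θ = (‖γ θ‖ : ℂ) * exp ((φ θ : ℂ) * I)) ∧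
    ∀ θ : ℝ, α < deriv φ θ

/-- Fully starlike harmonic mappings of order `α` of the disk. -/
def FullyStarlike (α : ℝ) (f : ℂ → ℂ) : Prop :=
  InnerProductSpace.HarmonicOnNhd f disk ∧ f 0 = 0 ∧
  ∀ r : ℝ, 0 < r → r < 1 →
    Set.InjOn f (sphere 0 r) ∧
    BoundsStarlikeDomain (f '' sphere 0 r) ∧
    ArgDerivGT (fun θ : ℝ => f ((r : ℂ) * exp ((θ : ℂ) * I))) α

/-- The class `𝓕𝓢*_H(α)`: functions in `𝓢*_H` that are fully starlike of order `α`. -/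
def ClassFSHStar (α : ℝ) : Set (ℂ → ℂ) :=
  {f | f ∈ ClassSHStar ∧ FullyStarlike α f}

end HarmonicMaps

end

noncomputable section

namespace HarmonicMaps

open Filter Topology Set

/-! Multiplying by `|f|²` turns the inequality into `α < Re ((z h' - conj (z g')) / f)`, and the
right side is the angular derivative of `arg f` (`starlikeness_inequality_iff`, `deriv_argument`).
The forward direction follows at once.

Conversely, univalence and starlikeness must come from this pointwise bound. Write `f (exp s) = exp
(L s)` on the left half-plane (`exists_isLogLift`). As `α ≥ 0`, `Im L` increases on vertical lines,
so each level set of `Im L` is a graph over `Re s < 0`. Along it `Re L` has derivative Jacobian /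
`∂_θ Im L > 0` (`exists_radial`). Hence `L` is injective and images of left half-planes are closed
under left translation; through `exp`, `f` is injective and each `f '' ball 0 r` is starlike. -/

/-- A lift `L` to logarithmic coordinates of a map of the punctured disk into the punctured plane
that is homotopic to the identity: `L` is defined on the left half-plane, commutes with the
translation by `2πi`, preserves orientation, and its imaginary part increases along vertical
lines. -/
structure IsLogLift (L : ℂ → ℂ) (L' : ℂ → ℂ →L[ℝ] ℂ) : Prop where
  hasFDerivAt : ∀ s : ℂ, s.re < 0 → HasFDerivAt L (L' s) s
  im_pos : ∀ s : ℂ, s.re < 0 → 0 < (L' s I).im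
  jacobian_pos : ∀ s : ℂ, s.re < 0 →
    0 < (L' s 1).re * (L' s I).im - (L' s I).re * (L' s 1).im
  add_period : ∀ s : ℂ, s.re < 0 → L (s + 2 * Real.pi * I) = L s + 2 * Real.pi * I

/-! ### Level curves of `Im L` -/

namespace IsLogLift

variable {L : ℂ → ℂ} {L' : ℂ → ℂ →L[ℝ] ℂ}

theorem hasDerivAt_im (hL : IsLogLift L L') {ρ : ℝ} (hρ : ρ < 0) (θ : ℝ) :
    HasDerivAt (fun t : ℝ => (L (ρ + t * I)).im) (L' (ρ + θ * I) I).im θ := by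
  have h1 : HasDerivAt (fun t : ℝ => (ρ : ℂ) + t * I) I θ := by
    simpa using ((ofRealCLM.hasDerivAt (x := θ)).mul_const I).const_add (ρ : ℂ)
  have h2 := (hL.hasFDerivAt (ρ + θ * I) (by simpa using hρ)).comp_hasDerivAt θ h1
  exact imCLM.hasFDerivAt.comp_hasDerivAt θ h2

theorem strictMono_im (hL : IsLogLift L L') {ρ : ℝ} (hρ : ρ < 0) :
    StrictMono (fun t : ℝ => (L (ρ + t * I)).im) :=
  strictMono_of_deriv_pos fun θ => by
    rw [(hL.hasDerivAt_im hρ θ).deriv]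
    exact hL.im_pos _ (by simpa using hρ)

theorem add_int_mul_period (hL : IsLogLift L L') {s : ℂ} (hs : s.re < 0) (n : ℤ) :
    L (s + n * (2 * Real.pi * I)) = L s + n * (2 * Real.pi * I) := by
  have hre (m : ℤ) : (s + m * (2 * Real.pi * I)).re < 0 := by simpa using hs
  induction n using Int.induction_on with
  | zero => simp
  | succ n ih =>
    have := hL.add_period _ (hre n)
    rw [ih] at this
    push_cast at this ⊢
    rw [show s + (n + 1) * (2 * Real.pi * I) = s + n * (2 * Real.pi * I) + 2 * Real.pi * I by ring,
      this]
    ring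
  | pred n ih =>
    have := hL.add_period _ (hre (-n - 1))
    push_cast at this ih ⊢
    rw [show s + (-n - 1) * (2 * Real.pi * I) + 2 * Real.pi * I = s + -n * (2 * Real.pi * I) by
      ring, ih] at this
    linear_combination -this

theorem surjective_im (hL : IsLogLift L L') {ρ : ℝ} (hρ : ρ < 0) (ψ : ℝ) :
    ∃ θ : ℝ, (L (ρ + θ * I)).im = ψ := by
  have hc : Continuous (fun t : ℝ => (L (ρ + t * I)).im) :=
    continuous_iff_continuousAt.2 fun θ => (hL.hasDerivAt_im hρ θ).continuousAt
  have key (n : ℤ) :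
      (L (ρ + ((n * (2 * Real.pi) : ℝ) : ℂ) * I)).im = (L ρ).im + n * (2 * Real.pi) := by
    have := congrArg im (hL.add_int_mul_period (s := ρ) (by simpa using hρ) n)
    simp only [add_im] at this
    rw [show ((n * (2 * Real.pi) : ℝ) : ℂ) * I = n * (2 * Real.pi * I) by push_cast; ring, this]
    simp
  have hπ := Real.two_pi_pos
  refine mem_range_of_exists_le_of_exists_ge hc
    ⟨(⌊(ψ - (L ρ).im) / (2 * Real.pi)⌋ : ℤ) * (2 * Real.pi), ?_⟩
    ⟨(⌈(ψ - (L ρ).im) / (2 * Real.pi)⌉ : ℤ) * (2 * Real.pi), ?_⟩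
  · rw [key]
    have := (le_div_iff₀ hπ).1 (Int.floor_le ((ψ - (L ρ).im) / (2 * Real.pi)))
    linarith
  · rw [key]
    have := (div_le_iff₀ hπ).1 (Int.le_ceil ((ψ - (L ρ).im) / (2 * Real.pi)))
    linarith

/-- By monotonicity in `θ`, `a < Θ ρ` iff `Im L (ρ + a i) < ψ`, an open condition in `ρ`; likewise
from above. -/
theorem continuousAt_of_im_eq (hL : IsLogLift L L') {ψ : ℝ} {Θ : ℝ → ℝ}
    (hΘ : ∀ ρ : ℝ, ρ < 0 → (L (ρ + Θ ρ * I)).im = ψ) {ρ : ℝ} (hρ : ρ < 0) :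
    ContinuousAt Θ ρ := by
  have hc (θ : ℝ) : ContinuousAt (fun x : ℝ => (L (x + θ * I)).im) ρ := by
    have h1 : ContinuousAt L ((ρ : ℂ) + θ * I) :=
      (hL.hasFDerivAt _ (by simpa using hρ)).continuousAt
    have h2 : ContinuousAt (fun x : ℝ => (x : ℂ) + θ * I) ρ := by fun_prop
    exact continuous_im.continuousAt.comp (ContinuousAt.comp (f := fun x : ℝ => (x : ℂ) + θ * I)
      h1 h2)
  rw [ContinuousAt, tendsto_order]
  refine ⟨fun a ha => ?_, fun a ha => ?_⟩
  · have h1 : (L (ρ + a * I)).im < ψ := by rw [← hΘ ρ hρ]; exact hL.strictMono_im hρ ha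
    filter_upwards [(hc a).eventually_lt continuousAt_const h1, Iio_mem_nhds hρ] with x hx hx0
    rw [← hΘ x hx0] at hx
    exact (hL.strictMono_im hx0).lt_iff_lt.1 hx
  · have h1 : ψ < (L (ρ + a * I)).im := by rw [← hΘ ρ hρ]; exact hL.strictMono_im hρ ha
    filter_upwards [continuousAt_const.eventually_lt (hc a) h1, Iio_mem_nhds hρ] with x hx hx0
    rw [← hΘ x hx0] at hx
    exact (hL.strictMono_im hx0).lt_iff_lt.1 hx

/-- The map `z ↦ Re z + i Im L z` straightens the curve to a horizontal line and has invertible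
derivative, so the continuous `Θ` is differentiable, with slope `-p / q`. -/
theorem hasDerivAt_of_im_eq (hL : IsLogLift L L') {ψ : ℝ} {Θ : ℝ → ℝ}
    (hΘ : ∀ ρ : ℝ, ρ < 0 → (L (ρ + Θ ρ * I)).im = ψ) {ρ : ℝ} (hρ : ρ < 0) :
    HasDerivAt (fun x : ℝ => (x : ℂ) + Θ x * I)
      (1 - ((L' (ρ + Θ ρ * I) 1).im / (L' (ρ + Θ ρ * I) I).im : ℝ) * I) ρ := by
  set s : ℂ := ρ + Θ ρ * I with hs
  have hsre : s.re < 0 := by simpa [hs] using hρ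
  set p := (L' s 1).im
  set q := (L' s I).im with hq
  have hq0 : q ≠ 0 := (hL.im_pos s hsre).ne'
  have hcont : ContinuousAt (fun x : ℝ => (x : ℂ) + Θ x * I) ρ := by
    have := hL.continuousAt_of_im_eq hΘ hρ
    have h2 : ContinuousAt (fun x : ℝ => (Θ x : ℂ)) ρ :=
      ContinuousAt.comp (g := ((↑) : ℝ → ℂ)) continuous_ofReal.continuousAt this
    exact continuous_ofReal.continuousAt.add (h2.mul continuousAt_const)
  have hA : HasFDerivAt (fun z : ℂ => (z.re : ℂ) + (L z).im * I)
      (reCLM.smulRight (1 : ℂ) + (imCLM.comp (L' s)).smulRight I) s := by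
    have h1 := (reCLM.hasFDerivAt (x := s)).smul_const (1 : ℂ)
    have h2 := ((imCLM.hasFDerivAt).comp s (hL.hasFDerivAt s hsre)).smul_const I
    refine (h1.add h2).congr_of_eventuallyEq (Eventually.of_forall fun z => ?_)
    simp
  have hh : HasFDerivAt (fun x : ℝ => (x : ℂ) + ψ * I) ofRealCLM ρ :=
    (ofRealCLM.hasFDerivAt (x := ρ)).add_const _
  have hcomp : (fun z : ℂ => (z.re : ℂ) + (L z).im * I) ∘ (fun x : ℝ => (x : ℂ) + Θ x * I)
      =ᶠ[𝓝 ρ] fun x : ℝ => (x : ℂ) + ψ * I := by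
    filter_upwards [Iio_mem_nhds hρ] with x hx
    simp [hΘ x hx]
  have hinv : Function.LeftInverse
      (reCLM.smulRight (1 - ((p / q : ℝ) : ℂ) * I) + imCLM.smulRight (((1 / q : ℝ) : ℂ) * I))
      (reCLM.smulRight (1 : ℂ) + (imCLM.comp (L' s)).smulRight I) := by
    intro w
    have hw : (L' s w).im = w.re * p + w.im * q := by
      have : w = w.re • (1 : ℂ) + w.im • I := by simp [re_add_im]
      conv_lhs => rw [this, map_add, map_smul, map_smul]
      simp [p, q]
    apply Complex.ext
    · simp
    · simp [hw]
      field_simp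
      ring
  have := (HasFDerivAt.of_comp_of_leftInverse (g := fun x : ℝ => (x : ℂ) + Θ x * I) hcont hA hh
    hcomp hinv).hasDerivAt
  simpa using this

/-- The level sets of `Im L` are curves, graphs over the negative half-line, along which `Re L`
increases. -/
theorem exists_radial (hL : IsLogLift L L') (ψ : ℝ) :
    ∃ Θ : ℝ → ℝ, (∀ ρ : ℝ, ρ < 0 → (L (ρ + Θ ρ * I)).im = ψ) ∧
      ContinuousOn (fun ρ : ℝ => (L (ρ + Θ ρ * I)).re) (Iio 0) ∧
      StrictMonoOn (fun ρ : ℝ => (L (ρ + Θ ρ * I)).re) (Iio 0) := by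
  have : ∀ ρ : ℝ, ∃ θ : ℝ, ρ < 0 → (L (ρ + θ * I)).im = ψ := fun ρ => by
    by_cases hρ : ρ < 0
    · obtain ⟨θ, hθ⟩ := hL.surjective_im hρ ψ
      exact ⟨θ, fun _ => hθ⟩
    · exact ⟨0, fun h => absurd h hρ⟩
  choose Θ hΘ using this
  have hd (ρ : ℝ) (hρ : ρ < 0) := reCLM.hasFDerivAt.comp_hasDerivAt ρ
    ((hL.hasFDerivAt (ρ + Θ ρ * I) (by simpa using hρ)).comp_hasDerivAt ρ
      (hL.hasDerivAt_of_im_eq hΘ hρ))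
  have hcont : ContinuousOn (fun ρ : ℝ => (L (ρ + Θ ρ * I)).re) (Iio 0) := fun ρ hρ =>
    (hd ρ hρ).continuousAt.continuousWithinAt
  refine ⟨Θ, hΘ, hcont, strictMonoOn_of_deriv_pos (convex_Iio 0) hcont fun ρ hρ => ?_⟩
  rw [interior_Iio] at hρ
  have hsre : ((ρ : ℂ) + Θ ρ * I).re < 0 := by simpa using hρ
  have hq := hL.im_pos _ hsre
  have hJ := hL.jacobian_pos _ hsre
  have hdρ : HasDerivAt (fun ρ : ℝ => (L (ρ + Θ ρ * I)).re) _ ρ := hd ρ hρ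
  rw [hdρ.deriv]
  set s : ℂ := ρ + Θ ρ * I
  have : L' s (1 - ((L' s 1).im / (L' s I).im : ℝ) * I)
      = L' s 1 - ((L' s 1).im / (L' s I).im) • L' s I := by
    rw [map_sub, ← map_smul, real_smul]
  rw [this]
  simp only [reCLM_apply, sub_re, real_smul, re_ofReal_mul]
  rw [← mul_pos_iff_of_pos_right hq]
  field_simp
  linarith

theorem injOn (hL : IsLogLift L L') : InjOn L {s | s.re < 0} := by
  intro s hs t ht hst
  obtain ⟨Θ, hΘ, -, hmono⟩ := hL.exists_radial (L s).im
  have key (z : ℂ) (hz : z.re < 0) (him : (L z).im = (L s).im) : z = z.re + Θ z.re * I := by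
    have h1 : (L (z.re + z.im * I)).im = (L (z.re + Θ z.re * I)).im := by
      rw [re_add_im, him, hΘ _ hz]
    rw [← (hL.strictMono_im hz).injective h1, re_add_im]
  have h1 := key s hs rfl
  have h2 := key t ht (by rw [hst])
  have : s.re = t.re := hmono.injOn hs ht (by
    rw [← h1, ← h2, hst])
  rw [h1, h2, this]

/-- If `Re L → -∞` at the left end of the half-plane, then the images of left half-planes are
closed under translation to the left. -/
theorem exists_eq_sub (hL : IsLogLift L L')
    (hbot : ∀ M : ℝ, ∃ ρ₀ < 0, ∀ s : ℂ, s.re ≤ ρ₀ → (L s).re ≤ M)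
    {s : ℂ} (hs : s.re < 0) {t : ℝ} (ht : 0 ≤ t) :
    ∃ s' : ℂ, s'.re ≤ s.re ∧ L s' = L s - t := by
  obtain ⟨Θ, hΘ, hcont, -⟩ := hL.exists_radial (L s).im
  have h1 : s = s.re + Θ s.re * I := by
    have h1 : (L (s.re + s.im * I)).im = (L (s.re + Θ s.re * I)).im := by
      rw [re_add_im, hΘ _ hs]
    rw [← (hL.strictMono_im hs).injective h1, re_add_im]
  obtain ⟨ρ₀, hρ₀, hM⟩ := hbot ((L s).re - t)
  have hmin : min ρ₀ s.re ≤ s.re := min_le_right _ _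
  -- Follow the level curve through `s` leftwards until `Re L` has dropped by `t`.
  obtain ⟨ρ, hρ, hρt⟩ := intermediate_value_Icc hmin
    (hcont.mono fun x hx => lt_of_le_of_lt hx.2 hs)
    (show (L s).re - t ∈ Icc _ _ from ⟨hM _ (by simp), by
      change _ ≤ (L (s.re + Θ s.re * I)).re
      rw [← h1]
      linarith⟩)
  refine ⟨ρ + Θ ρ * I, by simpa using hρ.2, Complex.ext ?_ ?_⟩
  · simpa using hρt
  · simpa using hΘ ρ (hρ.2.trans_lt hs)

end IsLogLift

/-! ### Local behaviour of `h + conj g` -/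

theorem isOpen_disk : IsOpen disk := isOpen_ball

theorem mem_disk {z : ℂ} : z ∈ disk ↔ ‖z‖ < 1 := by simp [disk]

/-- The real-linear map `w ↦ a w + conj (b w)`. -/
def realLinear (a b : ℂ) : ℂ →L[ℝ] ℂ :=
  a • (1 : ℂ →L[ℝ] ℂ) + (conjCLE : ℂ →L[ℝ] ℂ).comp (b • (1 : ℂ →L[ℝ] ℂ))

@[simp]
theorem realLinear_apply (a b w : ℂ) : realLinear a b w = a * w + conj (b * w) := by
  simp [realLinear]

theorem range_realLinear {a b : ℂ} (hab : ‖b‖ < ‖a‖) : (realLinear a b).range = ⊤ := by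
  refine LinearMap.range_eq_top.2 (LinearMap.injective_iff_surjective.1 ?_)
  refine (injective_iff_map_eq_zero _).2 fun w hw => ?_
  have hw : a * w + conj (b * w) = 0 := by simpa using hw
  by_contra hne
  have : ‖a * w‖ = ‖b * w‖ := by
    rw [eq_neg_of_add_eq_zero_left hw, norm_neg, norm_conj]
  rw [norm_mul, norm_mul] at this
  exact hab.ne' (mul_right_cancel₀ (norm_ne_zero_iff.2 hne) this)

section Decomposition

variable {f h g : ℂ → ℂ} (hh : DifferentiableOn ℂ h disk) (hg : DifferentiableOn ℂ g disk)
  (hf : ∀ z ∈ disk, f z = h z + conj (g z))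

include hh hg hf

theorem hasStrictFDerivAt_of_eq_add_conj {z : ℂ} (hz : z ∈ disk) :
    HasStrictFDerivAt f (realLinear (deriv h z) (deriv g z)) z := by
  have hn : disk ∈ 𝓝 z := isOpen_disk.mem_nhds hz
  have h1 := ((hh.analyticAt hn).hasStrictDerivAt).complexToReal_fderiv
  have h2 := ((hg.analyticAt hn).hasStrictDerivAt).complexToReal_fderiv
  have h3 : HasStrictFDerivAt (fun w => conj (g w))
      ((conjCLE : ℂ →L[ℝ] ℂ).comp (deriv g z • (1 : ℂ →L[ℝ] ℂ))) z :=
    (conjCLE : ℂ →L[ℝ] ℂ).hasStrictFDerivAt.comp z h2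
  refine (h1.add h3).congr_of_eventuallyEq ?_
  filter_upwards [hn] with w hw
  exact (hf w hw).symm

theorem dz_eq_deriv {z : ℂ} (hz : z ∈ disk) : dz f z = deriv h z := by
  rw [dz, (hasStrictFDerivAt_of_eq_add_conj hh hg hf hz).hasFDerivAt.fderiv]
  simp only [realLinear_apply, map_mul, conj_I, map_one]
  linear_combination (conj (deriv g z) - deriv h z) / 2 * I_sq

theorem dzbar_eq_conj_deriv {z : ℂ} (hz : z ∈ disk) : dzbar f z = conj (deriv g z) := by
  rw [dzbar, (hasStrictFDerivAt_of_eq_add_conj hh hg hf hz).hasFDerivAt.fderiv]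
  simp only [realLinear_apply, map_mul, conj_I, map_one]
  linear_combination (deriv h z - conj (deriv g z)) / 2 * I_sq

theorem norm_deriv_lt_of_sensePreserving (hsp : SensePreserving f) {z : ℂ} (hz : z ∈ disk) :
    ‖deriv g z‖ < ‖deriv h z‖ := by
  have := hsp z hz
  rwa [dz_eq_deriv hh hg hf hz, dzbar_eq_conj_deriv hh hg hf hz, norm_conj] at this

theorem continuousOn_of_eq_add_conj : ContinuousOn f disk := fun _ hz =>
  (hasStrictFDerivAt_of_eq_add_conj hh hg hf hz).continuousAt.continuousWithinAt

theorem isOpen_image_of_sensePreserving (hsp : SensePreserving f) {U : Set ℂ} (hU : IsOpen U)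
    (hUd : U ⊆ disk) : IsOpen (f '' U) := by
  rw [isOpen_iff_mem_nhds]
  rintro _ ⟨z, hz, rfl⟩
  rw [← (hasStrictFDerivAt_of_eq_add_conj hh hg hf (hUd hz)).map_nhds_eq_of_surj
    (range_realLinear (norm_deriv_lt_of_sensePreserving hh hg hf hsp (hUd hz)))]
  exact image_mem_map (hU.mem_nhds hz)

/-- Since `h'(0) = 1` and `|g'(0)| < 1`, `|f z - z| < |z|` near `0`. This later shows that `f` winds
once around the origin. -/
theorem eventually_div_mem_slitPlane (hsp : SensePreserving f) (hf0 : f 0 = 0) (hdz : dz f 0 = 1) :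
    ∀ᶠ z in 𝓝 (0 : ℂ), z ≠ 0 → f z / z ∈ slitPlane := by
  have h0 : (0 : ℂ) ∈ disk := by simp [disk]
  have hd := (hasStrictFDerivAt_of_eq_add_conj hh hg hf h0).hasFDerivAt
  have hb := norm_deriv_lt_of_sensePreserving hh hg hf hsp h0
  rw [dz_eq_deriv hh hg hf h0] at hdz
  rw [hdz] at hd hb
  rw [norm_one] at hb
  have hε : 0 < (1 - ‖deriv g 0‖) / 2 := by linarith
  filter_upwards [hd.isLittleO.def hε] with z hz hz0
  simp only [hf0, sub_zero, realLinear_apply, one_mul] at hz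
  have hpos : 0 < ‖z‖ := norm_pos_iff.2 hz0
  have h1 : ‖f z - z‖ < ‖z‖ := by
    calc ‖f z - z‖ = ‖(f z - (z + conj (deriv g 0 * z))) + conj (deriv g 0 * z)‖ := by
          congr 1; ring
      _ ≤ (1 - ‖deriv g 0‖) / 2 * ‖z‖ + ‖deriv g 0‖ * ‖z‖ := by
          refine (norm_add_le _ _).trans (add_le_add hz ?_)
          rw [norm_conj, norm_mul]
      _ < ‖z‖ := by nlinarith
  have h2 : f z / z = 1 + (f z - z) / z := by field_simp; ring
  rw [h2]
  apply mem_slitPlane_of_norm_lt_one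
  rw [norm_div]
  exact (div_lt_one hpos).2 h1

end Decomposition

/-! ### Construction of the logarithmic lift -/

/-- Such a `u` takes values in `2πiℤ`, which is countable and so totally disconnected. -/
theorem eqOn_of_exp_eq_one {S : Set ℂ} (hS : IsPreconnected S) {u : ℂ → ℂ}
    (hu : ContinuousOn u S) (hexp : ∀ s ∈ S, exp (u s) = 1) {x y : ℂ} (hx : x ∈ S) (hy : y ∈ S) :
    u x = u y := by
  have hc : (range fun n : ℤ => (n : ℂ) * (2 * Real.pi * I)).Countable := countable_range _
  refine hc.isTotallyDisconnected (u '' S) ?_ (hS.image u hu) (mem_image_of_mem u hx)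
    (mem_image_of_mem u hy)
  rintro _ ⟨s, hs, rfl⟩
  obtain ⟨n, hn⟩ := exp_eq_one_iff.1 (hexp s hs)
  exact ⟨n, hn.symm⟩

theorem exp_mem_disk {s : ℂ} (hs : s.re < 0) : exp s ∈ disk := by
  rw [mem_disk, norm_exp]
  exact Real.exp_lt_one_iff.2 hs

theorem isSimplyConnected_re_lt_zero : IsSimplyConnected {s : ℂ | s.re < 0} := by
  have := (convex_halfSpace_re_lt 0).contractibleSpace ⟨-1, by simp⟩
  exact SimplyConnectedSpace.ofContractible _

/-- A continuous logarithm of a differentiable function is differentiable. -/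
theorem hasFDerivAt_of_exp_eq {U : Set ℂ} (hU : IsOpen U) {L F : ℂ → ℂ} (hL : ContinuousOn L U)
    (hexp : ∀ s ∈ U, exp (L s) = F s) {s : ℂ} (hs : s ∈ U) {F' : ℂ →L[ℝ] ℂ}
    (hF : HasFDerivAt F F' s) : HasFDerivAt L ((F s)⁻¹ • F') s := by
  have hne : F s ≠ 0 := by rw [← hexp s hs]; exact exp_ne_zero _
  have h1 : HasFDerivAt (fun t => (F s)⁻¹ * F t) ((F s)⁻¹ • F') s := hF.const_mul _
  have hFs : (F s)⁻¹ * F s = 1 := inv_mul_cancel₀ hne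
  have h2 : HasFDerivAt (fun t => L s + log ((F s)⁻¹ * F t)) ((F s)⁻¹ • F') s := by
    have h3 : HasFDerivAt log ((1 : ℂ) • (1 : ℂ →L[ℝ] ℂ)) ((F s)⁻¹ * F s) := by
      rw [hFs]
      simpa using (hasStrictDerivAt_log one_mem_slitPlane).hasDerivAt.complexToReal_fderiv
    simpa [ContinuousLinearMap.one_def] using (h3.comp s h1).const_add (L s)
  refine h2.congr_of_eventuallyEq ?_
  have hc : ContinuousAt L s := hL.continuousAt (hU.mem_nhds hs)
  filter_upwards [hU.mem_nhds hs, hc.eventually (ball_mem_nhds (L s) Real.pi_pos)] with t ht htb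
  have him : |(L t - L s).im| < Real.pi := (abs_im_le_norm _).trans_lt (by rwa [← dist_eq_norm])
  rw [abs_lt] at him
  rw [← hexp s hs, ← hexp t ht, ← exp_neg, ← exp_add, neg_add_eq_sub,
    log_exp him.1 him.2.le]
  ring

theorem exists_isLogLift {f h g : ℂ → ℂ} (hh : DifferentiableOn ℂ h disk)
    (hg : DifferentiableOn ℂ g disk) (hf : ∀ z ∈ disk, f z = h z + conj (g z))
    (hsp : SensePreserving f) (hf0 : f 0 = 0) (hdz : dz f 0 = 1)
    (hne : ∀ z ∈ disk, z ≠ 0 → f z ≠ 0)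
    (hpos : ∀ z ∈ disk, z ≠ 0 → 0 < ((z * deriv h z - conj (z * deriv g z)) / f z).re) :
    ∃ (L : ℂ → ℂ) (L' : ℂ → ℂ →L[ℝ] ℂ), IsLogLift L L' ∧
      (∀ s : ℂ, s.re < 0 → exp (L s) = f (exp s)) ∧
      ∀ s : ℂ, s.re < 0 → (L' s I).im =
        ((exp s * deriv h (exp s) - conj (exp s * deriv g (exp s))) / f (exp s)).re := by
  have hUo : IsOpen {s : ℂ | s.re < 0} := isOpen_lt continuous_re continuous_const
  have hfc : ContinuousOn (fun s => f (exp s)) {s : ℂ | s.re < 0} :=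
    (continuousOn_of_eq_add_conj hh hg hf).comp continuous_exp.continuousOn
      fun s hs => exp_mem_disk hs
  obtain ⟨L, hLc, hLe⟩ := exists_continuousOn_eqOn_exp_comp isSimplyConnected_re_lt_zero hUo hfc
    (by rintro ⟨s, hs, h0⟩; exact hne _ (exp_mem_disk hs) (exp_ne_zero s) h0)
  have hexp (s : ℂ) (hs : s.re < 0) : exp (L s) = f (exp s) := hLe hs
  have him (s : ℂ) : ((f (exp s))⁻¹ • realLinear (deriv h (exp s) * exp s)
      (deriv g (exp s) * exp s)) I
      = I * ((exp s * deriv h (exp s) - conj (exp s * deriv g (exp s))) / f (exp s)) := by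
    simp only [smul_eq_mul, realLinear_apply, map_mul, conj_I, div_eq_mul_inv,
      FunLike.coe_smul, Pi.smul_apply]
    ring
  have him' (s : ℂ) : (((f (exp s))⁻¹ • realLinear (deriv h (exp s) * exp s)
      (deriv g (exp s) * exp s)) I).im
      = ((exp s * deriv h (exp s) - conj (exp s * deriv g (exp s))) / f (exp s)).re := by
    rw [him, I_mul_im]
  refine ⟨L, fun s => (f (exp s))⁻¹ • realLinear (deriv h (exp s) * exp s)
    (deriv g (exp s) * exp s), ⟨fun s hs => ?_, fun s hs => ?_, fun s hs => ?_, fun s hs => ?_⟩,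
    hexp, fun s _ => him' s⟩
  · have h1 := (hasStrictFDerivAt_of_eq_add_conj hh hg hf (exp_mem_disk hs)).hasFDerivAt
    have h2 := (hasDerivAt_exp s).complexToReal_fderiv
    refine hasFDerivAt_of_exp_eq hUo hLc hexp hs ((h1.comp s h2).congr_fderiv ?_)
    ext w
    simp [mul_assoc]
  · rw [him']
    exact hpos _ (exp_mem_disk hs) (exp_ne_zero s)
  · rw [him]
    set z := exp s
    have hz : z ∈ disk := exp_mem_disk hs
    have hfz : f z ≠ 0 := hne z hz (exp_ne_zero s)
    have hlt := norm_deriv_lt_of_sensePreserving hh hg hf hsp hz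
    set a := z * deriv h z / f z
    set b := conj (z * deriv g z) / f z
    have hab : ‖b‖ < ‖a‖ := by
      simp only [a, b, norm_div, norm_conj, norm_mul]
      have : 0 < ‖z‖ := norm_pos_iff.2 (exp_ne_zero s)
      have : 0 < ‖f z‖ := norm_pos_iff.2 hfz
      gcongr
    have h1 : ((f z)⁻¹ • realLinear (deriv h z * z) (deriv g z * z)) 1 = a + b := by
      simp only [smul_eq_mul, realLinear_apply, map_mul, map_one, div_eq_mul_inv,
        FunLike.coe_smul, Pi.smul_apply, a, b]
      ring
    have h2 : (z * deriv h z - conj (z * deriv g z)) / f z = a - b := by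
      simp only [a, b]; ring
    rw [h1, h2]
    -- With `L' 1 = a + b` and `L' I = I (a - b)`, the Jacobian is `|a|² - |b|²`.
    have h3 : normSq b < normSq a := by
      rw [normSq_eq_norm_sq, normSq_eq_norm_sq]
      gcongr
    rw [normSq_apply, normSq_apply] at h3
    simp only [I_mul_im, I_mul_re, add_re, add_im, sub_re, sub_im]
    linarith
  -- The increment of `L` over `2πi` is constant; far to the left it equals `2πi`, because `L t - t`
  -- differs by a constant from the principal logarithm of `f (exp t) / exp t`, which is periodic.
  · have hsh (t : ℂ) (ht : t.re < 0) : (t + 2 * Real.pi * I).re < 0 := by simpa using ht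
    have hee (t : ℂ) : exp (t + 2 * Real.pi * I) = exp t := exp_periodic t
    have hLc2 : ContinuousOn (fun t => L (t + 2 * Real.pi * I)) {t : ℂ | t.re < 0} :=
      hLc.comp (by fun_prop) hsh
    obtain ⟨δ, hδ, hδs⟩ := Metric.eventually_nhds_iff.1
      (eventually_div_mem_slitPlane hh hg hf hsp hf0 hdz)
    set ρ := min (Real.log δ) 0
    have hV (t : ℂ) (ht : t.re < ρ) : t.re < 0 := ht.trans_le (min_le_right _ _)
    have hk (t : ℂ) (ht : t.re < ρ) : f (exp t) / exp t ∈ slitPlane := by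
      refine hδs ?_ (exp_ne_zero t)
      rw [dist_zero_right, norm_exp]
      exact (Real.lt_log_iff_exp_lt hδ).1 (ht.trans_le (min_le_left _ _))
    have hpre : IsPreconnected {t : ℂ | t.re < ρ} := (convex_halfSpace_re_lt ρ).isPreconnected
    have hnear (t : ℂ) (ht : t.re < ρ) : L (t + 2 * Real.pi * I) = L t + 2 * Real.pi * I := by
      have := eqOn_of_exp_eq_one hpre (u := fun t => L t - t - log (f (exp t) / exp t))
        (((hLc.mono hV).sub continuousOn_id).sub
          (((hfc.mono hV).div continuous_exp.continuousOn fun t _ => exp_ne_zero t).clog hk))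
        (fun t ht => by
          have := slitPlane_ne_zero (hk t ht)
          rw [exp_sub, exp_sub, exp_log this, hexp t (hV t ht)]
          exact div_self this)
        (show t + 2 * Real.pi * I ∈ _ by simpa using ht) ht
      simp only [hee] at this
      linear_combination this
    have := eqOn_of_exp_eq_one (convex_halfSpace_re_lt 0).isPreconnected
      (u := fun t => L (t + 2 * Real.pi * I) - L t) (hLc2.sub hLc)
      (fun t ht => by
        rw [exp_sub, hexp t ht, hexp _ (hsh t ht), hee]
        exact div_self (hne _ (exp_mem_disk ht) (exp_ne_zero t)))
      hs (show ((ρ - 1 : ℝ) : ℂ) ∈ _ from hV _ (by simp))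
    have h2 := hnear ((ρ - 1 : ℝ) : ℂ) (by simp)
    linear_combination this + h2

/-! ### The angular derivative and the inequality -/

/-- `γ exp (-iφ)` is real, so its derivative has zero imaginary part. -/
theorem deriv_argument {γ : ℝ → ℂ} {γ' : ℂ} {θ : ℝ} (hγ : HasDerivAt γ γ' θ) (hne : γ θ ≠ 0)
    {φ : ℝ → ℝ} (hφ : DifferentiableAt ℝ φ θ)
    (hpolar : ∀ t : ℝ, γ t = (‖γ t‖ : ℂ) * exp ((φ t : ℂ) * I)) :
    deriv φ θ = (γ' / γ θ).im := by
  have hu (t : ℝ) : γ t * exp (-((φ t : ℂ) * I)) = (‖γ t‖ : ℂ) := by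
    conv_lhs => rw [hpolar t]
    rw [mul_assoc, ← exp_add, add_neg_cancel, exp_zero, mul_one]
  have h1 : HasDerivAt (fun t : ℝ => -((φ t : ℂ) * I)) (-(((deriv φ θ : ℝ) : ℂ) * I)) θ :=
    (hφ.hasDerivAt.ofReal_comp.mul_const I).fun_neg
  have h2 := hγ.mul h1.cexp
  have h3 := imCLM.hasFDerivAt.comp_hasDerivAt θ h2
  have h4 : HasDerivAt (fun _ : ℝ => (0 : ℝ)) _ θ := h3.congr_of_eventuallyEq
    (Eventually.of_forall fun t => by simp [hu t])
  have h5 := h4.unique (hasDerivAt_const θ (0 : ℝ))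
  have h6 : γ' * exp (-((φ θ : ℂ) * I)) + γ θ * (exp (-((φ θ : ℂ) * I)) * -(((deriv φ θ : ℝ) : ℂ) * I))
      = (‖γ θ‖ : ℂ) * (γ' / γ θ - ((deriv φ θ : ℝ) : ℂ) * I) := by
    rw [← hu θ]
    field_simp
    ring
  have h7 : (γ' * exp (-((φ θ : ℂ) * I))
      + γ θ * (exp (-((φ θ : ℂ) * I)) * -(((deriv φ θ : ℝ) : ℂ) * I))).im = 0 := h5
  rw [h6, im_ofReal_mul] at h7
  have h8 := (mul_eq_zero.1 h7).resolve_left (norm_ne_zero_iff.2 hne)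
  simp only [sub_im, mul_im, ofReal_re, I_im, ofReal_im, I_re] at h8
  linarith

/-- Division by zero gives `0`, matching the convention at zeros of `h` and `g`. -/
theorem sq_norm_mul_re_div (w x : ℂ) : ‖w‖ ^ 2 * (x / w).re = (x * conj w).re := by
  rcases eq_or_ne w 0 with rfl | hw
  · simp
  · rw [← normSq_eq_norm_sq, ← re_ofReal_mul, ← mul_conj]
    congr 1
    field_simp

theorem starlikeness_inequality_iff {α : ℝ} {z a b p q : ℂ} (hne : a + conj b ≠ 0) :
    ‖b‖ ^ 2 * ((z * q / b).re + α) + (z * a * q + 2 * (α : ℂ) * a * b - z * p * b).re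
        < ‖a‖ ^ 2 * ((z * p / a).re - α) ↔
      α < ((z * p - conj (z * q)) / (a + conj b)).re := by
  have hpos : 0 < ‖a + conj b‖ ^ 2 := by positivity
  rw [← mul_lt_mul_iff_right₀ (b := α) hpos, sq_norm_mul_re_div, mul_add, mul_sub, sq_norm_mul_re_div,
    sq_norm_mul_re_div, ← normSq_eq_norm_sq, ← normSq_eq_norm_sq, ← normSq_eq_norm_sq,
    ← sub_pos, ← sub_pos (b := _ * α)]
  apply Eq.to_iff
  congr 1
  simp only [normSq_apply, mul_re, mul_im, add_re, add_im, sub_re, sub_im, conj_re, conj_im,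
    ofReal_re, ofReal_im, re_ofNat, im_ofNat]
  ring

theorem hasDerivAt_circle (r θ : ℝ) :
    HasDerivAt (fun t : ℝ => (r : ℂ) * exp ((t : ℂ) * I)) (I * ((r : ℂ) * exp ((θ : ℂ) * I))) θ := by
  have h1 : HasDerivAt (fun t : ℝ => (t : ℂ) * I) I θ := by
    simpa using (ofRealCLM.hasDerivAt (x := θ)).mul_const I
  refine (h1.cexp.const_mul (r : ℂ)).congr_deriv ?_
  ring

section Decomposition

variable {f h g : ℂ → ℂ} (hh : DifferentiableOn ℂ h disk) (hg : DifferentiableOn ℂ g disk)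
  (hf : ∀ z ∈ disk, f z = h z + conj (g z))

include hh hg hf

theorem FullyStarlike.lt_re_div {α : ℝ} (hfs : FullyStarlike α f) {z : ℂ} (hz : z ∈ disk)
    (hz0 : z ≠ 0) :
    f z ≠ 0 ∧ α < ((z * deriv h z - conj (z * deriv g z)) / f z).re := by
  have hr : 0 < ‖z‖ := norm_pos_iff.2 hz0
  obtain ⟨-, -, hne, φ, hφ, hpolar, hlt⟩ := hfs.2.2 ‖z‖ hr (mem_disk.1 hz)
  have hzz : (‖z‖ : ℂ) * exp ((arg z : ℂ) * I) = z := norm_mul_exp_arg_mul_I z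
  have hfz : f z ≠ 0 := by simpa only [hzz] using hne (arg z)
  refine ⟨hfz, ?_⟩
  have hd : HasFDerivAt f (realLinear (deriv h z) (deriv g z))
      ((‖z‖ : ℂ) * exp ((arg z : ℂ) * I)) := by
    rw [hzz]
    exact (hasStrictFDerivAt_of_eq_add_conj hh hg hf hz).hasFDerivAt
  have hγ : HasDerivAt (fun t : ℝ => f ((‖z‖ : ℂ) * exp ((t : ℂ) * I))) _ (arg z) :=
    hd.comp_hasDerivAt (arg z) (hasDerivAt_circle ‖z‖ (arg z))
  have := hlt (arg z)
  rw [deriv_argument hγ (hne _) (hφ _) hpolar] at this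
  simp only [hzz, realLinear_apply] at this
  convert this using 1
  rw [← I_mul_im]
  congr 1
  simp only [map_mul, conj_I]
  ring

end Decomposition

/-! ### From the lift back to `f` -/

namespace IsLogLift

variable {f L : ℂ → ℂ} {L' : ℂ → ℂ →L[ℝ] ℂ}

/-- Equal values of `f` give values of `L` differing by `2πin`, which the period absorbs into the
argument. -/
theorem injOn_disk (hL : IsLogLift L L') (hexp : ∀ s : ℂ, s.re < 0 → exp (L s) = f (exp s))
    (hf0 : f 0 = 0) : InjOn f disk := by
  have hlog (z : ℂ) (hz : z ∈ disk) (hz0 : z ≠ 0) : (log z).re < 0 := by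
    rw [log_re]
    exact Real.log_neg (norm_pos_iff.2 hz0) (mem_disk.1 hz)
  have hne (z : ℂ) (hz : z ∈ disk) (hz0 : z ≠ 0) : f z ≠ 0 := by
    rw [← exp_log hz0, ← hexp _ (hlog z hz hz0)]
    exact exp_ne_zero _
  intro z hz w hw hzw
  rcases eq_or_ne z 0 with rfl | hz0
  · by_contra hw0
    exact hne w hw (Ne.symm hw0) (by rw [← hzw, hf0])
  rcases eq_or_ne w 0 with rfl | hw0
  · exact absurd (by rw [hzw, hf0]) (hne z hz hz0)
  have h1 : exp (L (log z)) = exp (L (log w)) := by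
    rw [hexp _ (hlog z hz hz0), hexp _ (hlog w hw hw0), exp_log hz0, exp_log hw0, hzw]
  obtain ⟨n, hn⟩ := exp_eq_exp_iff_exists_int.1 h1
  rw [← hL.add_int_mul_period (hlog w hw hw0)] at hn
  have h2 := hL.injOn (hlog z hz hz0)
    (show log w + n * (2 * Real.pi * I) ∈ _ by simpa using hlog w hw hw0) hn
  rw [← exp_log hz0, h2, exp_add, exp_log hw0, exp_int_mul_two_pi_mul_I, mul_one]

/-- Scaling by `a ∈ (0, 1]` is translation of `L` by `log a ≤ 0`; continuity at `0` sends `Re L` to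
`-∞`. -/
theorem starConvex_image_ball (hL : IsLogLift L L')
    (hexp : ∀ s : ℂ, s.re < 0 → exp (L s) = f (exp s)) (hf0 : f 0 = 0) (hc : ContinuousAt f 0)
    {r : ℝ} (hr0 : 0 < r) (hr1 : r ≤ 1) : StarConvex ℝ 0 (f '' ball 0 r) := by
  have hbot (M : ℝ) : ∃ ρ₀ < 0, ∀ s : ℂ, s.re ≤ ρ₀ → (L s).re ≤ M := by
    obtain ⟨δ, hδ, hδf⟩ := Metric.continuousAt_iff.1 hc (Real.exp M) (Real.exp_pos M)
    refine ⟨min (Real.log δ) 0 - 1, by linarith [min_le_right (Real.log δ) 0], fun s hs => ?_⟩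
    have hs0 : s.re < 0 := by linarith [min_le_right (Real.log δ) 0]
    have hsδ : s.re < Real.log δ := by linarith [min_le_left (Real.log δ) 0]
    have := hδf (x := exp s) (by
      rw [dist_zero_right, norm_exp]
      exact (Real.lt_log_iff_exp_lt hδ).1 hsδ)
    rw [hf0, dist_zero_right, ← hexp s hs0, norm_exp, Real.exp_lt_exp] at this
    exact this.le
  rw [starConvex_zero_iff]
  rintro _ ⟨z, hz, rfl⟩ a ha0 ha1
  have h0 : (0 : ℂ) ∈ f '' ball 0 r := ⟨0, by simpa using hr0, hf0⟩
  rcases eq_or_ne z 0 with rfl | hz0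
  · simpa [hf0] using h0
  rcases ha0.eq_or_lt with rfl | ha0
  · simpa using h0
  rw [mem_ball_zero_iff] at hz
  have hs : (log z).re < 0 := by
    rw [log_re]
    exact Real.log_neg (norm_pos_iff.2 hz0) (hz.trans_le hr1)
  obtain ⟨s, hss, hLs⟩ := hL.exists_eq_sub hbot hs (t := -Real.log a)
    (neg_nonneg.2 (Real.log_nonpos ha0.le ha1))
  refine ⟨exp s, ?_, ?_⟩
  · rw [mem_ball_zero_iff, norm_exp]
    refine lt_of_le_of_lt (Real.exp_le_exp.2 hss) ?_
    rwa [log_re, Real.exp_log (norm_pos_iff.2 hz0)]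
  · rw [← hexp s (hss.trans_lt hs), hLs, ofReal_neg, sub_neg_eq_add, exp_add, hexp _ hs,
      exp_log hz0, ← ofReal_exp, Real.exp_log ha0, real_smul, mul_comm]

theorem argDerivGT (hL : IsLogLift L L') (hexp : ∀ s : ℂ, s.re < 0 → exp (L s) = f (exp s))
    {α : ℝ} (hα : ∀ s : ℂ, s.re < 0 → α < (L' s I).im) {r : ℝ} (hr0 : 0 < r) (hr1 : r < 1) :
    ArgDerivGT (fun θ : ℝ => f ((r : ℂ) * exp ((θ : ℂ) * I))) α := by
  have hρ : Real.log r < 0 := Real.log_neg hr0 hr1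
  have hre (θ : ℝ) : ((Real.log r : ℂ) + θ * I).re < 0 := by simpa using hρ
  have hfe (θ : ℝ) : f ((r : ℂ) * exp ((θ : ℂ) * I)) = exp (L ((Real.log r : ℂ) + θ * I)) := by
    rw [hexp _ (hre θ), exp_add, ← ofReal_exp, Real.exp_log hr0]
  refine ⟨fun θ => (hfe θ).trans_ne (exp_ne_zero _),
    fun θ => (L ((Real.log r : ℂ) + θ * I)).im,
    fun θ => (hL.hasDerivAt_im hρ θ).differentiableAt, fun θ => ?_, fun θ => ?_⟩
  · simp only [hfe]
    rw [norm_exp, ofReal_exp, ← exp_add, re_add_im]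
  · rw [(hL.hasDerivAt_im hρ θ).deriv]
    exact hα _ (hre θ)

end IsLogLift

/-- Compactness makes the closure `f '' closedBall 0 r`; injectivity lets the open image be
subtracted. -/
theorem frontier_image_ball {f : ℂ → ℂ} (hinj : InjOn f disk) (hc : ContinuousOn f disk) {r : ℝ}
    (hr0 : 0 < r) (hr1 : r < 1) (hopen : IsOpen (f '' ball 0 r)) :
    frontier (f '' ball 0 r) = f '' sphere 0 r := by
  have hsub : closedBall (0 : ℂ) r ⊆ disk := closedBall_subset_ball hr1
  have hcc : ContinuousOn f (closedBall 0 r) := hc.mono hsub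
  have hcl : closure (f '' ball 0 r) = f '' closedBall 0 r := by
    refine Subset.antisymm
      (closure_minimal (image_mono ball_subset_closedBall)
        ((isCompact_closedBall 0 r).image_of_continuousOn hcc).isClosed) ?_
    rw [← closure_ball 0 hr0.ne'] at hcc ⊢
    exact hcc.image_closure
  rw [hopen.frontier_eq, hcl, ← (hinj.mono hsub).image_sdiff_subset ball_subset_closedBall,
    closedBall_sdiff_ball]

end HarmonicMaps

end

theorem theorem2p7 (α : ℝ) (hα0 : 0 ≤ α) (hα1 : α < 1) (f h g : ℂ → ℂ)
    (hh : DifferentiableOn ℂ h HarmonicMaps.disk)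
    (hg : DifferentiableOn ℂ g HarmonicMaps.disk)
    (hg0 : g 0 = 0)
    (hf : ∀ z ∈ HarmonicMaps.disk, f z = h z + conj (g z))
    (hfH : f ∈ HarmonicMaps.ClassH)
    (hsp : HarmonicMaps.SensePreserving f) :
    f ∈ HarmonicMaps.ClassFSHStar α ↔
      (∀ z : ℂ, 0 < ‖z‖ → ‖z‖ < 1 → f z ≠ 0) ∧
      (∀ z : ℂ, 0 < ‖z‖ → ‖z‖ < 1 →
        ‖g z‖ ^ 2 * ((z * deriv g z / g z).re + α)
            + (z * h z * deriv g z + 2 * (α : ℂ) * h z * g z - z * deriv h z * g z).re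
          < ‖h z‖ ^ 2 * ((z * deriv h z / h z).re - α)) := by
  have h0 : (0 : ℂ) ∈ HarmonicMaps.disk := by simp [HarmonicMaps.disk]
  have hpt (z : ℂ) : (z ∈ HarmonicMaps.disk ∧ z ≠ 0) ↔ (0 < ‖z‖ ∧ ‖z‖ < 1) := by
    rw [HarmonicMaps.mem_disk, norm_pos_iff, and_comm]
  constructor
  · rintro ⟨-, hfs⟩
    refine ⟨fun z hz0 hz1 => ?_, fun z hz0 hz1 => ?_⟩ <;>
      obtain ⟨hz, hz'⟩ := (hpt z).2 ⟨hz0, hz1⟩ <;>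
      obtain ⟨hne, hlt⟩ := hfs.lt_re_div hh hg hf hz hz'
    · exact hne
    · rw [hf z hz] at hne hlt
      exact (HarmonicMaps.starlikeness_inequality_iff hne).2 hlt
  · rintro ⟨hne, hineq⟩
    have hne' (z : ℂ) (hz : z ∈ HarmonicMaps.disk) (hz0 : z ≠ 0) : f z ≠ 0 :=
      hne z ((hpt z).1 ⟨hz, hz0⟩).1 ((hpt z).1 ⟨hz, hz0⟩).2
    have hlt (z : ℂ) (hz : z ∈ HarmonicMaps.disk) (hz0 : z ≠ 0) :
        α < ((z * deriv h z - conj (z * deriv g z)) / f z).re := by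
      have h1 := hne' z hz hz0
      have h2 := hineq z ((hpt z).1 ⟨hz, hz0⟩).1 ((hpt z).1 ⟨hz, hz0⟩).2
      rw [hf z hz] at h1 ⊢
      exact (HarmonicMaps.starlikeness_inequality_iff h1).1 h2
    obtain ⟨L, L', hL, hexp, him⟩ := HarmonicMaps.exists_isLogLift hh hg hf hsp hfH.2.1 hfH.2.2
      hne' fun z hz hz0 => hα0.trans_lt (hlt z hz hz0)
    have hinj := hL.injOn_disk hexp hfH.2.1
    have hcont := HarmonicMaps.continuousOn_of_eq_add_conj hh hg hf
    have hstar {r : ℝ} (hr0 : 0 < r) (hr1 : r ≤ 1) :=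
      hL.starConvex_image_ball hexp hfH.2.1
        (hcont.continuousAt (HarmonicMaps.isOpen_disk.mem_nhds h0)) hr0 hr1
    have hopen {r : ℝ} (hr1 : r ≤ 1) : IsOpen (f '' ball 0 r) :=
      HarmonicMaps.isOpen_image_of_sensePreserving hh hg hf hsp isOpen_ball
        (ball_subset_ball hr1)
    have hconn {r : ℝ} (hr0 : 0 < r) (hr1 : r ≤ 1) : IsConnected (f '' ball 0 r) :=
      ((convex_ball 0 r).isConnected ⟨0, mem_ball_self hr0⟩).image f
        (hcont.mono (ball_subset_ball hr1))
    refine ⟨⟨⟨hfH, hinj, hsp⟩, hopen le_rfl, hconn one_pos le_rfl, hstar one_pos le_rfl⟩,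
      hfH.1, hfH.2.1, fun r hr0 hr1 => ?_⟩
    have hsub : closedBall (0 : ℂ) r ⊆ HarmonicMaps.disk := closedBall_subset_ball hr1
    refine ⟨hinj.mono (sphere_subset_closedBall.trans hsub),
      ⟨f '' ball 0 r, hopen hr1.le, hconn hr0 hr1.le, ?_, hstar hr0 hr1.le,
        HarmonicMaps.frontier_image_ball hinj hcont hr0 hr1 (hopen hr1.le)⟩,
      hL.argDerivGT hexp (fun s hs => ?_) hr0 hr1⟩
    · exact (((isCompact_closedBall 0 r).image_of_continuousOn
        (hcont.mono hsub)).isBounded).subset (Set.image_mono ball_subset_closedBall)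
    · rw [him s hs]
      exact hlt _ (HarmonicMaps.exp_mem_disk hs) (exp_ne_zero s)
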